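/- Let $X_1,\dots,X_n$ ($n\ge 2$) be i.i.d. $N(\mu,\Sigma)$ random vectors in $\mathbb{R}^p$, $p\ge 1$, where $\mu\in\mathbb{R}^p$ is arbitrary and $\Sigma=(\sigma_{ij})$ belongs to the class $\mathcal{C}_\alpha(M_0,M_1)$ of symmetric $p\times p$ matrices with $\max_j\sum_{i:|i-j|\ge k}|\sigma_{ij}|\le M_1k^{-\alpha}$ for all integers $k>0$ and $0<M_0^{-1}\le\lambda_{\min}(\Sigma)$, $\lambda_{\max}(\Sigma)\le M_0$. Let $\hat\Sigma=(\hat\sigma_{ij})$, $\hat\sigma_{ij}=(n-1)^{-1}\sum_{a=1}^n(X_{a,i}-\bar X_i)(X_{a,j}-\bar X_j)$, be the sample covariance matrix. For $K\ge 1$ put $\hat\Sigma_K=(\hat\sigma_{ij}1_{|i-j|\le K-1})$ and $\Sigma_K=(\sigma_{ij}1_{|i-j|\le K-1})$. For a $p\times p$ matrix $A$ and $1\le k,\ell\le\lceil p/K\rceil$, let $A(k,\ell)$ be the block of $A$ with row indices in $[(k-1)K+1,kK]\cap[1,p]$ and column indices in $[(\ell-1)K+1,\ell K]\cap[1,p]$.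 (So $\hat\Sigma_K(k,k)=\hat\Sigma(k,k)$, while for $|k-\ell|=1$ the block $\hat\Sigma_K(k,\ell)$ is the entrywise product of $\hat\Sigma(k,\ell)$ with a strictly triangular 0-1 matrix.) Let $\Sigma^{abs}=(|\sigma_{ij}|)$, let $\|\cdot\|_{op}$ be the operator norm induced by the Euclidean norms, and let $$W=\max_{|k-\ell|\le 1}\|\hat\Sigma_K(k,\ell)-\Sigma_K(k,\ell)\|_{op}.$$ For every $\gamma$ there are constants $c,C>0$ depending only on $\gamma$, and for all $M_0,M_1$ a constant $D>0$ depending only on $\gamma,M_0,M_1$, such that, for all real $\alpha$ and all $n,p,K,\mu,\Sigma$ as above with $K+\log p\le\gamma n$, $$\mathbb{P}\Big\{W\ge c\,\|\Sigma^{abs}\|_{op}\sqrt{\tfrac{K+\log p}{n}}\Big\}\le \frac{C}{p}\qquad\text{and}\qquad \mathbb{E}\,W^2\le D\,\frac{K+\log p}{n}.$$ -/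

import Mathlib

open MeasureTheory ProbabilityTheory

noncomputable section

/-- The operator (spectral) norm of a real matrix, i.e. its norm as a linear map between
Euclidean spaces. -/
def opNorm {m n : Type*} [Fintype m] [Fintype n] [DecidableEq n] (A : Matrix m n ℝ) : ℝ :=
  ‖LinearMap.toContinuousLinearMap (Matrix.toEuclideanLin A)‖

/-- The matrix of absolute values of the entries. -/
def absMatrix {m n : Type*} (A : Matrix m n ℝ) : Matrix m n ℝ := fun i j => |A i j|

/-- The class of approximately banded covariance matrices with parameters `α`, `M₀`, `M₁`. -/
structure ApproxBanded {p : ℕ} (α M₀ M₁ : ℝ) (S : Matrix (Fin p) (Fin p) ℝ) : Prop where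
  /-- Decay of the off-diagonal entries, column by column. -/
  decay : ∀ k : ℕ, 0 < k → ∀ j : Fin p,
    ∑ i ∈ Finset.univ.filter (fun i : Fin p => (k : ℤ) ≤ |((i : ℕ) : ℤ) - ((j : ℕ) : ℤ)|), |S i j| ≤ M₁ * (k : ℝ) ^ (-α)
  /-- The matrix is symmetric and all its eigenvalues lie in `[M₀⁻¹, M₀]`, where `M₀⁻¹ > 0`. -/
  spectrum : 0 < M₀⁻¹ ∧
    ∃ h : S.IsHermitian, ∀ i, M₀⁻¹ ≤ h.eigenvalues i ∧ h.eigenvalues i ≤ M₀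

/-- The `j`-th coordinate of the sample mean of `x₁, …, xₙ`. -/
def sampleMean {n p : ℕ} (x : Fin n → EuclideanSpace ℝ (Fin p)) (j : Fin p) : ℝ :=
  (n : ℝ)⁻¹ * ∑ a, x a j

/-- The sample covariance matrix of `x₁, …, xₙ`, with normalization `1 / (n - 1)`. -/
def sampleCov {n p : ℕ} (x : Fin n → EuclideanSpace ℝ (Fin p)) : Matrix (Fin p) (Fin p) ℝ :=
  fun i j => ((n : ℝ) - 1)⁻¹ * ∑ a, (x a i - sampleMean x i) * (x a j - sampleMean x j)

/-- Banding with bandwidth `K`: the entries with `|i - j| ≤ K - 1` are kept, the others are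
replaced by zero. -/
def band {p : ℕ} (K : ℕ) (A : Matrix (Fin p) (Fin p) ℝ) : Matrix (Fin p) (Fin p) ℝ :=
  fun i j => if |((i : ℕ) : ℤ) - ((j : ℕ) : ℤ)| ≤ (K : ℤ) - 1 then A i j else 0

/-- The indices of the `k`-th group (all counted from zero), that is `kK ≤ i < (k + 1)K`. -/
abbrev BlockIndex (p K k : ℕ) : Type := {i : Fin p // k * K ≤ (i : ℕ) ∧ (i : ℕ) < (k + 1) * K}

/-- The block `A(k, l)` of a `p × p` matrix. It is a `K × K` matrix, except that the blocks in
the last row or column of blocks are smaller if `K` does not divide `p`. -/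
def block {p : ℕ} (K : ℕ) (A : Matrix (Fin p) (Fin p) ℝ) (k l : ℕ) :
    Matrix (BlockIndex p K k) (BlockIndex p K l) ℝ :=
  A.submatrix Subtype.val Subtype.val

/-- The number `⌈p / K⌉` of groups of indices. -/
def numBlocks (p K : ℕ) : ℕ := (p + K - 1) / K

/-- The maximum over all blocks `(k, l)` with `|k - l| ≤ 1` of `‖A(k, l) - B(k, l)‖`, in operator
norm. -/
def maxBlockDist {p : ℕ} (K : ℕ) (A B : Matrix (Fin p) (Fin p) ℝ) : ℝ :=
  ⨆ q : {q : Fin (numBlocks p K) × Fin (numBlocks p K) // |((q.1 : ℕ) : ℤ) - ((q.2 : ℕ) : ℤ)| ≤ 1},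
    opNorm (block K A q.1.1 q.1.2 - block K B q.1.1 q.1.2)

end

/-! Everything follows from one exponential moment: with L = ‖Σ^abs‖ and 64 s L ≤ n, E exp(sW) is at
most p² 25^K exp(512 (sL)²/n) (`exp_maxBlockDist`). With sL of order √(n (K + log p)) this is at
most exp(5 (K + log p)). Chernoff's inequality then gives the tail, and bounding W² by a constant
plus a multiple of exp(sW) gives the second moment.

To bound the moment, W is replaced by four times the largest bilinear form over 1/2-nets of the unit
balls of the blocks (`exists_opNorm_le_four_mul`). There are at most p² blocks and 25^K pairs of net
points in each, and the exponential of a maximum is at most the sum of the exponentials. Each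
bilinear form is ∑ B i j (σ̂ i j - σ i j), where B is u vᵀ with the entries off the band erased
(`dotProduct_block_band_mulVec`). Erasing entries destroys the rank one structure but not the
domination |B i j| ≤ |u i| |v j|, and this alone gives tr(Σ B Σ Bᵀ) ≤ L²
(`trace_mul_mul_mul_transpose_le`). This is why absolute values enter.

The trace bounds the squared Frobenius norm of the symmetrization of Σ^(1/2) B Σ^(1/2). In an
eigenbasis of the latter, the Gaussian quadratic form becomes a weighted sum of independent centred
chi-squares, which is sub-exponential (`exp_centredForm_multivariateGaussian`). The unknown mean
costs one further quadratic form, in the normalized sum of the sample, split off by convexity of exp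
(`exp_sampleCov`). -/

/-! ### One-dimensional chi-square moments. -/

/-- The inequality `-log (1 - u) ≤ u + u ^ 2`, in exponential form. -/
lemma exp_neg_add_sq_le_one_sub {u : ℝ} (hu : |u| ≤ 1 / 2) :
    Real.exp (-(u + u ^ 2)) ≤ 1 - u := by
  obtain ⟨h1, h2⟩ := abs_le.1 hu
  rcases le_total 0 u with h0 | h0
  · have h := Real.quadratic_le_exp_of_nonneg (show 0 ≤ u + u ^ 2 by positivity)
    rw [Real.exp_neg, inv_le_comm₀ (Real.exp_pos _) (by linarith)]
    refine le_trans ?_ h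
    rw [inv_le_iff_one_le_mul₀ (by linarith)]
    have h3 : 0 ≤ u ^ 2 * ((1 - u) * (1 + u) ^ 2 / 2 - u) := by
      apply mul_nonneg (sq_nonneg u)
      nlinarith [mul_nonneg h0 (sub_nonneg.2 h2), mul_nonneg (mul_nonneg h0 h0) (sub_nonneg.2 h2)]
    nlinarith
  · have hx : |-(u + u ^ 2)| ≤ 1 := by
      rw [abs_le]; constructor <;> nlinarith
    have h := (abs_le.1 (Real.abs_exp_sub_one_sub_id_le hx)).2
    have h3 : 0 ≤ u ^ 2 * (-u * (2 + u)) :=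
      mul_nonneg (sq_nonneg u) (mul_nonneg (by linarith) (by linarith))
    nlinarith

lemma gaussianPDFReal_mul_exp_sq (θ x : ℝ) :
    gaussianPDFReal 0 1 x * Real.exp (θ * (x ^ 2 - 1)) =
      (√(2 * Real.pi))⁻¹ * Real.exp (-θ) * Real.exp (-(1 / 2 - θ) * x ^ 2) := by
  simp only [gaussianPDFReal, NNReal.coe_one, mul_one, sub_zero]
  rw [mul_assoc, mul_assoc, ← Real.exp_add, ← Real.exp_add]
  congr 2
  ring

lemma integrable_exp_mul_sq_sub_one {θ : ℝ} (hθ : |θ| ≤ 1 / 4) :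
    Integrable (fun x : ℝ => Real.exp (θ * (x ^ 2 - 1))) (gaussianReal 0 1) := by
  have h2 := (abs_le.1 hθ).2
  rw [gaussianReal_of_var_ne_zero _ one_ne_zero,
    integrable_withDensity_iff (by fun_prop) (ae_of_all _ fun _ => gaussianPDF_lt_top)]
  simp only [toReal_gaussianPDF]
  simp_rw [mul_comm _ (gaussianPDFReal 0 1 _), gaussianPDFReal_mul_exp_sq]
  exact (integrable_exp_neg_mul_sq (by linarith)).const_mul _

/-- A centred chi-square variable is sub-exponential. -/
lemma integral_exp_mul_sq_sub_one_le {θ : ℝ} (hθ : |θ| ≤ 1 / 4) :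
    ∫ x : ℝ, Real.exp (θ * (x ^ 2 - 1)) ∂(gaussianReal 0 1) ≤ Real.exp (2 * θ ^ 2) := by
  obtain ⟨h1, h2⟩ := abs_le.1 hθ
  rw [integral_gaussianReal_eq_integral_smul one_ne_zero]
  simp_rw [smul_eq_mul, gaussianPDFReal_mul_exp_sq]
  rw [integral_const_mul, integral_gaussian, ← Real.sqrt_inv, mul_right_comm, ← Real.sqrt_mul
    (by positivity)]
  -- The integral equals exp(-θ) (1 - 2θ)^(-1/2), so the elementary inequality is used at u = 2θ.
  have hu : |2 * θ| ≤ 1 / 2 := by rw [abs_mul, abs_two]; linarith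
  have h := exp_neg_add_sq_le_one_sub hu
  have h3 : (2 * Real.pi)⁻¹ * (Real.pi / (1 / 2 - θ)) = (1 - 2 * θ)⁻¹ := by
    have := Real.pi_pos
    have h4 : 1 / 2 - θ ≠ 0 := by linarith
    have h5 : 1 - 2 * θ ≠ 0 := by linarith
    have h6 : 1 - θ * 2 ≠ 0 := by linarith
    field_simp
  have h4 : √((1 - 2 * θ)⁻¹) ≤ Real.exp (θ + 2 * θ ^ 2) := by
    rw [Real.sqrt_le_iff]
    refine ⟨(Real.exp_pos _).le, ?_⟩
    rw [inv_le_comm₀ (by linarith) (by positivity), ← Real.exp_nat_mul, ← Real.exp_neg]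
    refine le_trans (le_of_eq ?_) h
    congr 1; push_cast; ring
  rw [h3]
  calc √((1 - 2 * θ)⁻¹) * Real.exp (-θ) ≤ Real.exp (θ + 2 * θ ^ 2) * Real.exp (-θ) := by gcongr
    _ = Real.exp (2 * θ ^ 2) := by rw [← Real.exp_add]; congr 1; ring

/-! ### Quadratic forms in standard Gaussian vectors. -/

section
variable {ι : Type*} [Fintype ι] [DecidableEq ι]

open Matrix WithLp

/-- Both sides are the trace of A². -/
lemma Matrix.IsHermitian.sum_sq_eq_sum_eigenvalues_sq {A : Matrix ι ι ℝ} (hA : A.IsHermitian) :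
    ∑ i, ∑ j, A i j ^ 2 = ∑ i, hA.eigenvalues i ^ 2 := by
  have h1 : ∑ i, ∑ j, A i j ^ 2 = (A * A).trace := by
    simp only [Matrix.trace, Matrix.diag, Matrix.mul_apply]
    refine Finset.sum_congr rfl fun i _ => Finset.sum_congr rfl fun j _ => ?_
    have : A j i = A i j := by simpa using hA.apply i j
    rw [this, sq]
  rw [h1]
  have h := hA.spectral_theorem
  set U := hA.eigenvectorUnitary
  have h2 : A * A = (U : Matrix ι ι ℝ) * (diagonal hA.eigenvalues * diagonal hA.eigenvalues) *
      star (U : Matrix ι ι ℝ) := by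
    have h3 : star (U : Matrix ι ι ℝ) * (U : Matrix ι ι ℝ) = 1 := Unitary.coe_star_mul_self U
    have h4 : A = (U : Matrix ι ι ℝ) * diagonal hA.eigenvalues * star (U : Matrix ι ι ℝ) := by
      simpa [Unitary.conjStarAlgAut_apply, Function.comp_def] using h
    calc A * A = (U : Matrix ι ι ℝ) * diagonal hA.eigenvalues * star (U : Matrix ι ι ℝ) *
          ((U : Matrix ι ι ℝ) * diagonal hA.eigenvalues * star (U : Matrix ι ι ℝ)) := by
            rw [← h4]
      _ = (U : Matrix ι ι ℝ) * diagonal hA.eigenvalues * (star (U : Matrix ι ι ℝ) *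
          (U : Matrix ι ι ℝ)) * diagonal hA.eigenvalues * star (U : Matrix ι ι ℝ) := by
            simp only [Matrix.mul_assoc]
      _ = _ := by rw [h3]; simp only [Matrix.mul_assoc, Matrix.one_mul]
  rw [h2, Matrix.trace_mul_comm, ← Matrix.mul_assoc, Unitary.coe_star_mul_self, Matrix.one_mul,
    Matrix.diagonal_mul_diagonal, Matrix.trace_diagonal]
  simp [sq]

lemma Matrix.IsHermitian.dotProduct_mulVec_sum_eigenvectorBasis {A : Matrix ι ι ℝ}
    (hA : A.IsHermitian) (x : ι → ℝ) :
    ofLp (∑ i, x i • hA.eigenvectorBasis i) ⬝ᵥ A *ᵥ ofLp (∑ i, x i • hA.eigenvectorBasis i) =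
      ∑ i, hA.eigenvalues i * x i ^ 2 := by
  have h1 : toLp 2 (A *ᵥ ofLp (∑ i, x i • hA.eigenvectorBasis i)) =
      ∑ i, (hA.eigenvalues i * x i) • hA.eigenvectorBasis i := by
    simp only [ofLp_sum, ofLp_smul, Matrix.mulVec_sum, Matrix.mulVec_smul,
      hA.mulVec_eigenvectorBasis, toLp_sum, toLp_smul, smul_smul, mul_comm]
  have h2 := EuclideanSpace.inner_eq_star_dotProduct (𝕜 := ℝ)
    (toLp 2 (A *ᵥ ofLp (∑ i, x i • hA.eigenvectorBasis i))) (∑ i, x i • hA.eigenvectorBasis i)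
  rw [star_trivial] at h2
  rw [← h2, h1, hA.eigenvectorBasis.orthonormal.inner_sum]
  refine Finset.sum_congr rfl fun i _ => ?_
  simp; ring

/-- Exponential moments of a symmetric quadratic form in standard Gaussian variables. -/
lemma exp_quadraticForm_stdGaussian {A : Matrix ι ι ℝ} (hA : A.IsHermitian) {s : ℝ}
    (hs : s ^ 2 * ∑ i, ∑ j, A i j ^ 2 ≤ 1 / 16) :
    Integrable (fun z : EuclideanSpace ℝ ι => Real.exp (s * (ofLp z ⬝ᵥ A *ᵥ ofLp z - A.trace)))
        (stdGaussian (EuclideanSpace ℝ ι)) ∧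
      ∫ z : EuclideanSpace ℝ ι, Real.exp (s * (ofLp z ⬝ᵥ A *ᵥ ofLp z - A.trace))
        ∂(stdGaussian (EuclideanSpace ℝ ι)) ≤ Real.exp (2 * (s ^ 2 * ∑ i, ∑ j, A i j ^ 2)) := by
  have hcont : Continuous fun z : EuclideanSpace ℝ ι =>
      Real.exp (s * (ofLp z ⬝ᵥ A *ᵥ ofLp z - A.trace)) := by
    simp only [dotProduct, Matrix.mulVec]
    fun_prop
  have hmeas : Measurable fun x : ι → ℝ => ∑ i, x i • hA.eigenvectorBasis i := by fun_prop
  have heq : ∀ x : ι → ℝ, Real.exp (s * (ofLp (∑ i, x i • hA.eigenvectorBasis i) ⬝ᵥ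
      A *ᵥ ofLp (∑ i, x i • hA.eigenvectorBasis i) - A.trace)) =
      ∏ i, Real.exp (s * hA.eigenvalues i * (x i ^ 2 - 1)) := by
    intro x
    rw [hA.dotProduct_mulVec_sum_eigenvectorBasis, hA.trace_eq_sum_eigenvalues, ← Real.exp_sum]
    simp only [RCLike.ofReal_real_eq_id, id_eq]
    rw [← Finset.sum_sub_distrib, Finset.mul_sum]
    congr 1
    exact Finset.sum_congr rfl fun i _ => by ring
  -- Each squared eigenvalue is at most the squared Frobenius norm, and 1/16 = (1/4)².
  have hsmall : ∀ i, |s * hA.eigenvalues i| ≤ 1 / 4 := by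
    intro i
    refine abs_le_of_sq_le_sq ?_ (by norm_num)
    rw [hA.sum_sq_eq_sum_eigenvalues_sq] at hs
    have h1 : hA.eigenvalues i ^ 2 ≤ ∑ i, hA.eigenvalues i ^ 2 :=
      Finset.single_le_sum (f := fun i => hA.eigenvalues i ^ 2) (fun _ _ => sq_nonneg _)
        (Finset.mem_univ i)
    have h2 := mul_le_mul_of_nonneg_left h1 (sq_nonneg s)
    rw [mul_pow]; norm_num; linarith
  -- By rotation invariance the coordinates in the eigenbasis are independent standard normals, so
  -- the expectation factorizes.
  rw [stdGaussian_eq_map_pi_orthonormalBasis hA.eigenvectorBasis]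
  constructor
  · rw [integrable_map_measure hcont.aestronglyMeasurable hmeas.aemeasurable]
    simp only [Function.comp_def, heq]
    exact Integrable.fintype_prod
      (f := fun i (x : ℝ) => Real.exp (s * hA.eigenvalues i * (x ^ 2 - 1)))
      fun i => integrable_exp_mul_sq_sub_one (hsmall i)
  · rw [integral_map hmeas.aemeasurable hcont.aestronglyMeasurable]
    simp only [heq]
    rw [integral_fintype_prod_eq_prod
      (f := fun i (x : ℝ) => Real.exp (s * hA.eigenvalues i * (x ^ 2 - 1))),
      hA.sum_sq_eq_sum_eigenvalues_sq, Finset.mul_sum, Finset.mul_sum, Real.exp_sum]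
    refine Finset.prod_le_prod (fun i _ => integral_nonneg fun _ => (Real.exp_pos _).le)
      fun i _ => ?_
    refine (integral_exp_mul_sq_sub_one_le (hsmall i)).trans_eq ?_
    rw [mul_pow]

end

/-! ### Quadratic forms with general mean and covariance. -/

section
variable {ι : Type*} [Fintype ι]

open Matrix WithLp

/-- The centred quadratic form `∑ B i j ((y i - m i) (y j - m j) - S i j)`. -/
def centredForm (m : EuclideanSpace ℝ ι) (S B : Matrix ι ι ℝ) (y : EuclideanSpace ℝ ι) : ℝ :=
  ∑ i, ∑ j, B i j * ((y i - m i) * (y j - m j) - S i j)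

lemma continuous_centredForm (m : EuclideanSpace ℝ ι) (S B : Matrix ι ι ℝ) :
    Continuous (centredForm m S B) := by
  unfold centredForm
  fun_prop

variable [DecidableEq ι]

open scoped MatrixOrder in
/-- Exponential moments of a quadratic form in Gaussian variables. -/
lemma exp_centredForm_multivariateGaussian (m : EuclideanSpace ℝ ι) {S : Matrix ι ι ℝ}
    (hS : S.PosSemidef) (B : Matrix ι ι ℝ) {s F : ℝ} (hF : (S * B * S * Bᵀ).trace ≤ F)
    (hs : s ^ 2 * F ≤ 1 / 16) :
    Integrable (fun y => Real.exp (s * centredForm m S B y)) (multivariateGaussian m S) ∧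
      ∫ y, Real.exp (s * centredForm m S B y) ∂(multivariateGaussian m S) ≤
        Real.exp (2 * (s ^ 2 * F)) := by
  set R : Matrix ι ι ℝ := CFC.sqrt S with hR
  have hRR : R * R = S := CFC.sqrt_mul_sqrt_self S hS.nonneg
  have hRt : Rᵀ = R := by
    have := (Matrix.nonneg_iff_posSemidef.1 (CFC.sqrt_nonneg S)).isHermitian
    rwa [Matrix.IsHermitian, Matrix.conjTranspose_eq_transpose_of_trivial] at this
  have hSt : Sᵀ = S := by rw [← hRR, Matrix.transpose_mul, hRt]
  set C : Matrix ι ι ℝ := R * B * R with hC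
  -- B need not be symmetric; symmetrizing C keeps its quadratic form and trace and does not
  -- increase its Frobenius norm.
  set A : Matrix ι ι ℝ := (2⁻¹ : ℝ) • (C + Cᵀ) with hA
  have hAH : A.IsHermitian := by
    rw [Matrix.IsHermitian, Matrix.conjTranspose_eq_transpose_of_trivial, hA,
      Matrix.transpose_smul, Matrix.transpose_add, Matrix.transpose_transpose, add_comm]
  have hAF : ∑ i, ∑ j, A i j ^ 2 ≤ F := by
    have h1 : ∑ i, ∑ j, C i j ^ 2 = (S * B * S * Bᵀ).trace := by
      have h2 : ∑ i, ∑ j, C i j ^ 2 = (C * Cᵀ).trace := by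
        simp [Matrix.trace, Matrix.mul_apply, sq]
      rw [h2, hC, Matrix.transpose_mul, Matrix.transpose_mul, hRt]
      have h3 : R * B * R * (R * (Bᵀ * R)) = R * (B * (R * R) * Bᵀ * R) := by
        simp only [Matrix.mul_assoc]
      rw [h3, Matrix.trace_mul_comm, hRR, Matrix.mul_assoc, hRR, Matrix.trace_mul_comm]
      simp only [Matrix.mul_assoc]
    have h4 : ∑ i, ∑ j, C j i ^ 2 = ∑ i, ∑ j, C i j ^ 2 := Finset.sum_comm
    have h5 : ∑ i, ∑ j, A i j ^ 2 ≤
        2⁻¹ * (∑ i, ∑ j, C i j ^ 2) + 2⁻¹ * ∑ i, ∑ j, C j i ^ 2 := by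
      simp only [Finset.mul_sum, ← Finset.sum_add_distrib]
      refine Finset.sum_le_sum fun i _ => Finset.sum_le_sum fun j _ => ?_
      simp only [hA, Matrix.smul_apply, Matrix.add_apply, Matrix.transpose_apply, smul_eq_mul]
      nlinarith [sq_nonneg (C i j - C j i)]
    linarith
  have hq : ∀ z : EuclideanSpace ℝ ι,
      centredForm m S B (m + toEuclideanCLM (𝕜 := ℝ) R z) =
        ofLp z ⬝ᵥ A *ᵥ ofLp z - A.trace := by
    intro z
    have h1 : A.trace = ∑ i, ∑ j, B i j * S i j := by
      have h2 : A.trace = C.trace := by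
        rw [hA, Matrix.trace_smul, Matrix.trace_add, Matrix.trace_transpose, smul_eq_mul]; ring
      have h3 : C.trace = (B * Sᵀ).trace := by
        rw [hC, Matrix.mul_assoc, Matrix.trace_mul_comm, Matrix.mul_assoc, hRR, hSt]
      rw [h2, h3]
      simp [Matrix.trace, Matrix.mul_apply]
    have h2 : ofLp z ⬝ᵥ A *ᵥ ofLp z = (R *ᵥ ofLp z) ⬝ᵥ B *ᵥ (R *ᵥ ofLp z) := by
      have h3 : ofLp z ⬝ᵥ Cᵀ *ᵥ ofLp z = ofLp z ⬝ᵥ C *ᵥ ofLp z := by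
        rw [Matrix.mulVec_transpose, dotProduct_comm, ← Matrix.dotProduct_mulVec]
      have h4 : ofLp z ⬝ᵥ A *ᵥ ofLp z = ofLp z ⬝ᵥ C *ᵥ ofLp z := by
        rw [hA, Matrix.smul_mulVec, Matrix.add_mulVec, dotProduct_smul, dotProduct_add, h3,
          smul_eq_mul]
        ring
      rw [h4, hC, ← Matrix.mulVec_mulVec, ← Matrix.mulVec_mulVec, Matrix.dotProduct_mulVec,
        ← Matrix.mulVec_transpose, hRt]
    rw [h1, h2]
    simp only [centredForm, PiLp.add_apply, add_sub_cancel_left, dotProduct, Matrix.mulVec,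
      mul_sub, Finset.sum_sub_distrib, Finset.mul_sum, Matrix.ofLp_toEuclideanCLM]
    congr 1
    refine Finset.sum_congr rfl fun i _ => Finset.sum_congr rfl fun j _ => ?_
    simp only [Finset.mul_sum, Finset.sum_mul]
    refine Finset.sum_congr rfl fun k _ => Finset.sum_congr rfl fun l _ => ?_
    ring
  have hs' : s ^ 2 * ∑ i, ∑ j, A i j ^ 2 ≤ s ^ 2 * F :=
    mul_le_mul_of_nonneg_left hAF (sq_nonneg s)
  obtain ⟨h1, h2⟩ := exp_quadraticForm_stdGaussian hAH (hs'.trans hs)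
  have hcont : Continuous fun y => Real.exp (s * centredForm m S B y) :=
    Real.continuous_exp.comp ((continuous_centredForm m S B).const_mul s)
  have hmeas : Measurable fun z : EuclideanSpace ℝ ι => m + toEuclideanCLM (𝕜 := ℝ) R z := by
    fun_prop
  unfold multivariateGaussian
  rw [integrable_map_measure hcont.aestronglyMeasurable hmeas.aemeasurable,
    integral_map hmeas.aemeasurable hcont.aestronglyMeasurable]
  simp only [Function.comp_def, hq]
  exact ⟨h1, h2.trans (Real.exp_le_exp.2 (by linarith))⟩

/-! ### Operator norm and the trace bound. -/

lemma opNorm_nonneg {m n : Type*} [Fintype m] [Fintype n] [DecidableEq n] (A : Matrix m n ℝ) :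
    0 ≤ opNorm A := norm_nonneg _

lemma dotProduct_mulVec_le_opNorm {m n : Type*} [Fintype m] [Fintype n] [DecidableEq n]
    (A : Matrix m n ℝ) (u : EuclideanSpace ℝ m) (v : EuclideanSpace ℝ n) :
    ofLp u ⬝ᵥ A *ᵥ ofLp v ≤ opNorm A * ‖u‖ * ‖v‖ := by
  have h2 := EuclideanSpace.inner_eq_star_dotProduct (𝕜 := ℝ) (toLp 2 (A *ᵥ ofLp v)) u
  rw [star_trivial] at h2
  rw [← h2]
  have h3 : ‖toLp 2 (A *ᵥ ofLp v)‖ ≤ opNorm A * ‖v‖ :=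
    (LinearMap.toContinuousLinearMap (Matrix.toEuclideanLin A)).le_opNorm v
  calc _ ≤ ‖toLp 2 (A *ᵥ ofLp v)‖ * ‖u‖ := real_inner_le_norm _ _
    _ ≤ (opNorm A * ‖v‖) * ‖u‖ := by gcongr
    _ = _ := by ring

/-- For a matrix `B` dominated by a rank one matrix, `tr (S B S Bᵀ)` is controlled by the operator
norm of the matrix of absolute values of `S`. -/
lemma trace_mul_mul_mul_transpose_le {S B : Matrix ι ι ℝ} {u v : EuclideanSpace ℝ ι}
    (hu : ‖u‖ ≤ 1) (hv : ‖v‖ ≤ 1) (hB : ∀ i j, |B i j| ≤ |u i| * |v j|) :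
    (S * B * S * Bᵀ).trace ≤ opNorm (absMatrix S) ^ 2 := by
  have key : ∀ w : EuclideanSpace ℝ ι, ‖w‖ ≤ 1 →
      0 ≤ ∑ i, ∑ j, |w i| * (|S i j| * |w j|) ∧
      ∑ i, ∑ j, |w i| * (|S i j| * |w j|) ≤ opNorm (absMatrix S) := by
    intro w hw
    refine ⟨by positivity, ?_⟩
    have hn : ‖(toLp 2 fun i => |w i| : EuclideanSpace ℝ ι)‖ = ‖w‖ := by
      simp [EuclideanSpace.norm_eq]
    have h := dotProduct_mulVec_le_opNorm (absMatrix S) (toLp 2 fun i => |w i|)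
      (toLp 2 fun i => |w i|)
    rw [hn] at h
    simp only [dotProduct, Matrix.mulVec, absMatrix, Finset.mul_sum] at h
    refine h.trans ?_
    rw [mul_assoc]
    exact mul_le_of_le_one_right (opNorm_nonneg _) (mul_le_one₀ hw (norm_nonneg _) hw)
  have h1 : (S * B * S * Bᵀ).trace = ∑ i, ∑ l, ∑ k, ∑ j, S i j * B j k * S k l * B i l := by
    simp only [Matrix.trace, Matrix.diag, Matrix.mul_apply, Matrix.transpose_apply,
      Finset.sum_mul]
  have h2 : (∑ i, ∑ j, |u i| * (|S i j| * |u j|)) * (∑ k, ∑ l, |v k| * (|S k l| * |v l|)) =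
      ∑ i, ∑ l, ∑ k, ∑ j, |u i| * (|S i j| * |u j|) * (|v k| * (|S k l| * |v l|)) := by
    rw [Finset.sum_mul]
    refine Finset.sum_congr rfl fun i _ => ?_
    rw [Finset.sum_mul_sum]
    simp only [Finset.mul_sum]
    rw [Finset.sum_comm]
    rw [Finset.sum_comm]
    rw [Finset.sum_comm (γ := ι)]
    rw [Finset.sum_congr rfl fun k _ => Finset.sum_comm]
    rw [Finset.sum_comm]
  -- Each of the two factors B contributes one |u| and one |v|; regrouping pairs the two |u| across
  -- one S and the two |v| across the other.
  have h3 : (S * B * S * Bᵀ).trace ≤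
      (∑ i, ∑ j, |u i| * (|S i j| * |u j|)) * (∑ k, ∑ l, |v k| * (|S k l| * |v l|)) := by
    rw [h1, h2]
    refine Finset.sum_le_sum fun i _ => Finset.sum_le_sum fun l _ => Finset.sum_le_sum fun k _ =>
      Finset.sum_le_sum fun j _ => (le_abs_self _).trans ?_
    rw [abs_mul, abs_mul, abs_mul]
    calc |S i j| * |B j k| * |S k l| * |B i l|
        ≤ |S i j| * (|u j| * |v k|) * |S k l| * (|u i| * |v l|) := by
          gcongr
          · exact hB j k
          · exact hB i l
      _ = _ := by ring
  obtain ⟨h4, h5⟩ := key u hu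
  obtain ⟨h6, h7⟩ := key v hv
  calc _ ≤ _ := h3
    _ ≤ opNorm (absMatrix S) * opNorm (absMatrix S) := mul_le_mul h5 h7 h6 (opNorm_nonneg _)
    _ = _ := (sq _).symm

end

/-! ### Linear functionals of the sample covariance. -/

section
variable {Ω : Type*} [MeasurableSpace Ω] {P : Measure Ω} [IsProbabilityMeasure P]

open Matrix WithLp

/-- The normalized sum of independent Gaussian vectors with a common law. -/
lemma hasLaw_sqrt_smul_sum {ι : Type*} [Fintype ι] [DecidableEq ι] {n : ℕ} (hn : n ≠ 0)
    {m : EuclideanSpace ℝ ι} {S : Matrix ι ι ℝ} (hS : S.PosSemidef)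
    {X : Fin n → Ω → EuclideanSpace ℝ ι} (hX : iIndepFun X P)
    (hlaw : ∀ a, HasLaw (X a) (multivariateGaussian m S) P) :
    HasLaw (fun ω => (√n)⁻¹ • ∑ a, X a ω) (multivariateGaussian (√n • m) S) P := by
  have hm : ∀ a, AEMeasurable (X a) P := fun a => (hlaw a).aemeasurable
  have hsum : AEMeasurable (fun ω => ∑ a, X a ω) P :=
    Finset.aemeasurable_fun_sum _ fun a _ => hm a
  have hn0 : (0 : ℝ) < n := by positivity
  have hsq : √(n : ℝ) ^ 2 = n := Real.sq_sqrt hn0.le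
  have hsp : 0 < √(n : ℝ) := Real.sqrt_pos.2 hn0
  have hscaled : AEMeasurable (fun ω => (√n)⁻¹ • ∑ a, X a ω) P := hsum.const_smul (√(n : ℝ))⁻¹
  have : IsProbabilityMeasure (P.map fun ω => (√n)⁻¹ • ∑ a, X a ω) :=
    Measure.isProbabilityMeasure_map hscaled
  refine ⟨hscaled, Measure.ext_of_charFun ?_⟩
  ext t
  rw [charFun_map_smul_comp hsum, hX.charFun_map_fun_sum_eq_prod hm]
  simp only [Finset.prod_apply, (hlaw _).map_eq, charFun_multivariateGaussian hS,
    Finset.prod_const, Finset.card_univ, Fintype.card_fin, ← Complex.exp_nat_mul]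
  congr 1
  simp only [ofLp_smul, Matrix.mulVec_smul, dotProduct_smul, smul_dotProduct, smul_eq_mul,
    inner_smul_left, inner_smul_right, Complex.ofReal_mul, Complex.ofReal_inv, conj_trivial]
  have hc : ((√(n : ℝ) : ℝ) : ℂ) ^ 2 = n := by rw [← Complex.ofReal_pow, hsq]; simp
  have hc0 : ((√(n : ℝ) : ℝ) : ℂ) ≠ 0 := by exact_mod_cast hsp.ne'
  rw [← hc]
  field_simp

/-- Exponential moments of a linear functional of the error of the sample covariance matrix. -/
lemma exp_sampleCov {n p : ℕ} (hn : 2 ≤ n) {m : EuclideanSpace ℝ (Fin p)}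
    {S : Matrix (Fin p) (Fin p) ℝ} (hS : S.PosSemidef)
    {X : Fin n → Ω → EuclideanSpace ℝ (Fin p)} (hX : iIndepFun X P)
    (hlaw : ∀ a, HasLaw (X a) (multivariateGaussian m S) P)
    (B : Matrix (Fin p) (Fin p) ℝ) {s F : ℝ} (hF : (S * B * S * Bᵀ).trace ≤ F) (hF0 : 0 ≤ F)
    (hs : 256 * (s ^ 2 * F) ≤ (n : ℝ) ^ 2) :
    Integrable (fun ω => Real.exp
        (s * ∑ i, ∑ j, B i j * (sampleCov (fun a => X a ω) i j - S i j))) P ∧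
      ∫ ω, Real.exp (s * ∑ i, ∑ j, B i j * (sampleCov (fun a => X a ω) i j - S i j)) ∂P ≤
        Real.exp (32 * (s ^ 2 * F / n)) := by
  have hn2 : (2 : ℝ) ≤ n := by exact_mod_cast hn
  have hn0 : (n : ℝ) ≠ 0 := by positivity
  -- The 2 offsets the weights 1/2 in the convexity step; n² ≤ 4 (n - 1)² for n ≥ 2 then gives n² t²
  -- ≤ 16 s².
  set t : ℝ := 2 * s / (n - 1) with ht
  have ht2 : n ^ 2 * (t ^ 2 * F) ≤ 16 * (s ^ 2 * F) := by
    have h1 : (n : ℝ) ^ 2 ≤ 4 * (n - 1) ^ 2 := by nlinarith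
    have h2 : (n - 1 : ℝ) ^ 2 * (t ^ 2 * F) = 4 * (s ^ 2 * F) := by
      have : (n : ℝ) - 1 ≠ 0 := by linarith
      rw [ht]; field_simp; ring
    have h3 : 0 ≤ t ^ 2 * F := by positivity
    nlinarith [mul_le_mul_of_nonneg_right h1 h3]
  have htF : t ^ 2 * F ≤ 1 / 16 := by
    have h1 : (n : ℝ) ^ 2 * (t ^ 2 * F) ≤ n ^ 2 * (1 / 16) := by linarith
    exact le_of_mul_le_mul_left h1 (by positivity)
  set Z : Ω → EuclideanSpace ℝ (Fin p) := fun ω => (√n)⁻¹ • ∑ a, X a ω with hZ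
  have hZlaw : HasLaw Z (multivariateGaussian (√n • m) S) P :=
    hasLaw_sqrt_smul_sum (by omega) hS hX hlaw
  set Y : Fin n → Ω → ℝ := fun a ω => centredForm m S B (X a ω) with hY
  have hYm : ∀ a, AEMeasurable (Y a) P := fun a =>
    (continuous_centredForm m S B).measurable.comp_aemeasurable (hlaw a).aemeasurable
  have hYind : iIndepFun Y P :=
    hX.comp (fun _ => centredForm m S B) fun _ => (continuous_centredForm m S B).measurable
  -- (n - 1) σ̂ is the scatter about the true mean minus the rank one term of the centred Z.
  -- Subtracting S from each of the n + 1 products balances exactly.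
  have hdec : ∀ ω, s * ∑ i, ∑ j, B i j * (sampleCov (fun a => X a ω) i j - S i j) =
      2⁻¹ * (t * (∑ a, Y a) ω) + 2⁻¹ * (-t * centredForm (√n • m) S B (Z ω)) := by
    intro ω
    have hent : ∀ i j, sampleCov (fun a => X a ω) i j - S i j = ((n : ℝ) - 1)⁻¹ *
        (∑ a, ((X a ω i - m i) * (X a ω j - m j) - S i j) -
          ((Z ω i - (√n • m) i) * (Z ω j - (√n • m) j) - S i j)) := by
      intro i j
      have hsq : √(n : ℝ) ^ 2 = n := Real.sq_sqrt (by positivity)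
      have hsp : √(n : ℝ) ≠ 0 := by positivity
      have hn1 : (n : ℝ) - 1 ≠ 0 := by linarith
      have hz : ∀ i, Z ω i - (√n • m) i = √n * (sampleMean (fun a => X a ω) i - m i) := by
        intro i
        simp only [hZ, sampleMean, PiLp.smul_apply, smul_eq_mul, mul_sub, WithLp.ofLp_sum,
          Finset.sum_apply]
        have hinv : (√(n : ℝ))⁻¹ = √n * (n : ℝ)⁻¹ := by
          nth_rewrite 3 [← hsq]
          field_simp
        rw [hinv, mul_assoc]
      have hmean : ∀ i, ∑ a, X a ω i = n * sampleMean (fun a => X a ω) i := by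
        intro i
        rw [sampleMean]; field_simp
      rw [hz, hz]
      simp only [sampleCov]
      have hS1 : ∀ c d : Fin p → ℝ, ∑ a, (X a ω i - c i) * (X a ω j - d j) =
          ∑ a, X a ω i * X a ω j - d j * (∑ a, X a ω i) - c i * (∑ a, X a ω j)
            + n * (c i * d j) := by
        intro c d
        simp only [Finset.mul_sum, ← Finset.sum_sub_distrib]
        have : (n : ℝ) * (c i * d j) = ∑ _a : Fin n, c i * d j := by simp
        rw [this, ← Finset.sum_add_distrib]
        exact Finset.sum_congr rfl fun a _ => by ring
      rw [Finset.sum_sub_distrib,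
        hS1 (sampleMean fun a => X a ω) (sampleMean fun a => X a ω), hS1 m m, hmean, hmean]
      simp only [Finset.sum_const, Finset.card_univ, Fintype.card_fin, nsmul_eq_mul]
      field_simp
      rw [hsq]
      ring
    have hsum : ∑ i, ∑ j, B i j * (sampleCov (fun a => X a ω) i j - S i j) =
        ((n : ℝ) - 1)⁻¹ * (∑ a, centredForm m S B (X a ω) -
          centredForm (√n • m) S B (Z ω)) := by
      have hswap : ∑ a, centredForm m S B (X a ω) = ∑ i, ∑ j, B i j *
          ∑ a, ((X a ω i - m i) * (X a ω j - m j) - S i j) := by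
        simp only [centredForm]
        rw [Finset.sum_comm]
        refine Finset.sum_congr rfl fun i _ => ?_
        rw [Finset.sum_comm]
        exact Finset.sum_congr rfl fun j _ => (Finset.mul_sum _ _ _).symm
      rw [hswap, centredForm, ← Finset.sum_sub_distrib, Finset.mul_sum]
      refine Finset.sum_congr rfl fun i _ => ?_
      rw [← Finset.sum_sub_distrib, Finset.mul_sum]
      refine Finset.sum_congr rfl fun j _ => ?_
      rw [hent]
      ring
    rw [hsum, Finset.sum_apply, ht]
    ring
  have hsingle : ∀ a, mgf (Y a) P t ≤ Real.exp (2 * (t ^ 2 * F)) ∧ 0 < mgf (Y a) P t := by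
    intro a
    obtain ⟨h1, h2⟩ := exp_centredForm_multivariateGaussian m hS B hF htF
    have hc : Continuous fun y => Real.exp (t * centredForm m S B y) :=
      Real.continuous_exp.comp ((continuous_centredForm m S B).const_mul t)
    rw [← (hlaw a).map_eq] at h1 h2
    rw [integral_map (hlaw a).aemeasurable hc.aestronglyMeasurable] at h2
    rw [integrable_map_measure hc.aestronglyMeasurable (hlaw a).aemeasurable] at h1
    exact ⟨h2, mgf_pos h1⟩
  -- If integrability failed, the moment generating function would take its default value 0, yet it
  -- is a product of positive factors.
  have hsumI : Integrable (fun ω => Real.exp (t * (∑ a, Y a) ω)) P := by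
    by_contra h
    have h1 := hYind.mgf_sum₀ (t := t) hYm Finset.univ
    rw [mgf_undef h] at h1
    exact (Finset.prod_pos fun a _ => (hsingle a).2).ne h1
  have hsumB : ∫ ω, Real.exp (t * (∑ a, Y a) ω) ∂P ≤ Real.exp (32 * (s ^ 2 * F / n)) := by
    have h1 := hYind.mgf_sum₀ (t := t) hYm Finset.univ
    rw [mgf] at h1
    rw [h1]
    refine (Finset.prod_le_prod (fun a _ => (hsingle a).2.le) fun a _ => (hsingle a).1).trans ?_
    rw [Finset.prod_const, Finset.card_univ, Fintype.card_fin, ← Real.exp_nat_mul]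
    refine Real.exp_le_exp.2 ?_
    rw [mul_div_assoc', le_div_iff₀ (by positivity)]
    nlinarith
  have hmeanIB : Integrable (fun ω => Real.exp (-t * centredForm (√n • m) S B (Z ω))) P ∧
      ∫ ω, Real.exp (-t * centredForm (√n • m) S B (Z ω)) ∂P ≤
        Real.exp (32 * (s ^ 2 * F / n)) := by
    obtain ⟨h1, h2⟩ := exp_centredForm_multivariateGaussian (√n • m) hS B (s := -t) hF
      (by rwa [neg_sq])
    have hc : Continuous fun y => Real.exp (-t * centredForm (√n • m) S B y) :=
      Real.continuous_exp.comp ((continuous_centredForm _ S B).const_mul _)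
    rw [← hZlaw.map_eq] at h1 h2
    rw [integral_map hZlaw.aemeasurable hc.aestronglyMeasurable] at h2
    rw [integrable_map_measure hc.aestronglyMeasurable hZlaw.aemeasurable] at h1
    refine ⟨h1, h2.trans (Real.exp_le_exp.2 ?_)⟩
    rw [neg_sq, mul_div_assoc', le_div_iff₀ (by positivity)]
    have h3 : 0 ≤ t ^ 2 * F := by positivity
    nlinarith [mul_le_mul_of_nonneg_right (show (n : ℝ) ≤ n ^ 2 by nlinarith) h3]
  have hconv : ∀ ω, Real.exp (s * ∑ i, ∑ j, B i j * (sampleCov (fun a => X a ω) i j - S i j)) ≤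
      2⁻¹ * Real.exp (t * (∑ a, Y a) ω) +
        2⁻¹ * Real.exp (-t * centredForm (√n • m) S B (Z ω)) := by
    intro ω
    rw [hdec]
    exact convexOn_exp.2 (Set.mem_univ _) (Set.mem_univ _) (by norm_num) (by norm_num)
      (by norm_num)
  have hdomI := (hsumI.const_mul 2⁻¹).add (hmeanIB.1.const_mul 2⁻¹)
  have hI : Integrable (fun ω => Real.exp
      (s * ∑ i, ∑ j, B i j * (sampleCov (fun a => X a ω) i j - S i j))) P := by
    refine hdomI.mono' ?_ (ae_of_all _ fun ω => ?_)
    · have h1 : AEMeasurable (∑ a, Y a) P := Finset.aemeasurable_sum _ fun a _ => hYm a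
      have h2 : AEMeasurable (fun ω => centredForm (√n • m) S B (Z ω)) P :=
        (continuous_centredForm _ S B).measurable.comp_aemeasurable hZlaw.aemeasurable
      simp only [hdec]
      exact (Real.measurable_exp.comp_aemeasurable (((h1.const_mul _).const_mul _).add
        ((h2.const_mul _).const_mul _))).aestronglyMeasurable
    · rw [Real.norm_of_nonneg (Real.exp_pos _).le]
      exact hconv ω
  refine ⟨hI, (integral_mono hI hdomI hconv).trans ?_⟩
  simp only [Pi.add_apply]
  rw [integral_add (hsumI.const_mul 2⁻¹) (hmeanIB.1.const_mul 2⁻¹), integral_const_mul,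
    integral_const_mul]
  linarith [hmeanIB.2]

end

/-! ### Nets and operator norms. -/

section
open Matrix WithLp

/-- The unit ball of a finite-dimensional space has a `1 / 2`-net with at most `5 ^ d` points. -/
lemma exists_half_net (E : Type*) [NormedAddCommGroup E] [NormedSpace ℝ E]
    [FiniteDimensional ℝ E] :
    ∃ T : Finset E, T.card ≤ 5 ^ Module.finrank ℝ E ∧
      ∀ x : E, ‖x‖ ≤ 1 → ∃ t ∈ T, ‖t‖ ≤ 1 ∧ ‖x - t‖ ≤ 1 / 2 := by
  classical
  -- Cardinalities of 1-separated sets in the ball of radius 2. A set of maximal cardinality is a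
  -- 1-net there, and halving it gives the required net.
  let N : Set ℕ := {k | ∃ s : Finset E, (∀ c ∈ s, ‖c‖ ≤ 2) ∧
    (∀ c ∈ s, ∀ d ∈ s, c ≠ d → 1 ≤ ‖c - d‖) ∧ s.card = k}
  have hne : N.Nonempty := ⟨0, ∅, by simp, by simp, rfl⟩
  have hb : BddAbove N := by
    refine ⟨5 ^ Module.finrank ℝ E, ?_⟩
    rintro k ⟨s, h1, h2, rfl⟩
    exact Besicovitch.card_le_of_separated s h1 h2
  obtain ⟨s, h1, h2, h3⟩ := Nat.sSup_mem hne hb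
  refine ⟨s.image fun c => (2⁻¹ : ℝ) • c, Finset.card_image_le.trans
    (Besicovitch.card_le_of_separated s h1 h2), fun x hx => ?_⟩
  have hx2 : ‖(2 : ℝ) • x‖ ≤ 2 := by rw [norm_smul]; norm_num; linarith
  obtain ⟨t, hts, ht⟩ : ∃ t ∈ s, ‖(2 : ℝ) • x - t‖ ≤ 1 := by
    by_contra! hcon
    have hnot : (2 : ℝ) • x ∉ s := fun h => by
      have h0 := hcon _ h
      rw [sub_self, norm_zero] at h0
      exact absurd h0 (by norm_num)
    have hmem : s.card + 1 ∈ N := by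
      refine ⟨insert ((2 : ℝ) • x) s, ?_, ?_, Finset.card_insert_of_notMem hnot⟩
      · intro c hc
        rcases Finset.mem_insert.1 hc with rfl | hc
        exacts [hx2, h1 c hc]
      · intro c hc d hd hcd
        rcases Finset.mem_insert.1 hc with rfl | hc <;> rcases Finset.mem_insert.1 hd with rfl | hd
        · exact absurd rfl hcd
        · exact (hcon d hd).le
        · rw [norm_sub_rev]; exact (hcon c hc).le
        · exact h2 c hc d hd hcd
    have := le_csSup hb hmem
    omega
  refine ⟨(2⁻¹ : ℝ) • t, Finset.mem_image_of_mem _ hts, ?_, ?_⟩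
  · rw [norm_smul]; norm_num; linarith [h1 t hts]
  · have : x - (2⁻¹ : ℝ) • t = (2⁻¹ : ℝ) • ((2 : ℝ) • x - t) := by
      rw [smul_sub, smul_smul]; norm_num
    rw [this, norm_smul]; norm_num; linarith

variable {m n : Type*} [Fintype m] [Fintype n]

lemma exists_dotProduct_mulVec_eq_norm (A : Matrix m n ℝ) (v : EuclideanSpace ℝ n) :
    ∃ x : EuclideanSpace ℝ m, ‖x‖ ≤ 1 ∧
      ofLp x ⬝ᵥ A *ᵥ ofLp v = ‖(toLp 2 (A *ᵥ ofLp v) : EuclideanSpace ℝ m)‖ := by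
  set w : EuclideanSpace ℝ m := toLp 2 (A *ᵥ ofLp v) with hw
  refine ⟨‖w‖⁻¹ • w, ?_, ?_⟩
  · rw [norm_smul, norm_inv, norm_norm]; exact inv_mul_le_one
  · have h : A *ᵥ ofLp v = ofLp w := rfl
    rw [h, ofLp_smul, smul_dotProduct]
    have h2 := EuclideanSpace.inner_eq_star_dotProduct (𝕜 := ℝ) w w
    rw [star_trivial, real_inner_self_eq_norm_sq] at h2
    rw [← h2, smul_eq_mul]
    by_cases h0 : ‖w‖ = 0
    · simp [h0]
    · field_simp

variable [DecidableEq n]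

lemma opNorm_le_of_forall_dotProduct_le {A : Matrix m n ℝ} {c : ℝ}
    (h : ∀ (u : EuclideanSpace ℝ m) (v : EuclideanSpace ℝ n), ‖u‖ ≤ 1 → ‖v‖ ≤ 1 →
      ofLp u ⬝ᵥ A *ᵥ ofLp v ≤ c) : opNorm A ≤ c := by
  refine ContinuousLinearMap.opNorm_le_of_unit_norm (by simpa using h 0 0 (by simp) (by simp))
    fun v hv => ?_
  obtain ⟨x, hx, hxv⟩ := exists_dotProduct_mulVec_eq_norm A v
  exact hxv.symm.trans_le (h x v hx hv.le)

/-- The operator norm is controlled by the values of the bilinear form on `1 / 2`-nets. -/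
lemma exists_opNorm_le_four_mul (A : Matrix m n ℝ) {T : Finset (EuclideanSpace ℝ m)}
    {T' : Finset (EuclideanSpace ℝ n)}
    (hT : ∀ x, ‖x‖ ≤ 1 → ∃ t ∈ T, ‖t‖ ≤ 1 ∧ ‖x - t‖ ≤ 1 / 2)
    (hT' : ∀ x, ‖x‖ ≤ 1 → ∃ t ∈ T', ‖t‖ ≤ 1 ∧ ‖x - t‖ ≤ 1 / 2) :
    ∃ u ∈ T, ∃ v ∈ T', ‖u‖ ≤ 1 ∧ ‖v‖ ≤ 1 ∧ opNorm A ≤ 4 * (ofLp u ⬝ᵥ A *ᵥ ofLp v) := by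
  classical
  obtain ⟨u₀, hu₀, hu₀', -⟩ := hT 0 (by simp)
  obtain ⟨v₀, hv₀, hv₀', -⟩ := hT' 0 (by simp)
  obtain ⟨⟨u, v⟩, huv, hmax⟩ := Finset.exists_max_image
    ((T.filter (‖·‖ ≤ 1)) ×ˢ (T'.filter (‖·‖ ≤ 1))) (fun q => ofLp q.1 ⬝ᵥ A *ᵥ ofLp q.2)
    ⟨(u₀, v₀), by simp [*]⟩
  simp only [Finset.mem_product, Finset.mem_filter] at huv hmax
  refine ⟨u, huv.1.1, v, huv.2.1, huv.1.2, huv.2.2, ?_⟩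
  set c := ofLp u ⬝ᵥ A *ᵥ ofLp v
  -- Discretizing the left vector gives ‖A y'‖ ≤ c + ‖A y'‖ / 2; discretizing the right vector costs
  -- another `opNorm A / 2`. Both halves are absorbed.
  have hbound : opNorm A ≤ 2 * c + opNorm A / 2 := by
    refine opNorm_le_of_forall_dotProduct_le fun x y hx hy => ?_
    obtain ⟨y', hy', hyn, hyy⟩ := hT' y hy
    have hw : ‖(toLp 2 (A *ᵥ ofLp y') : EuclideanSpace ℝ m)‖ ≤ 2 * c := by
      set w : EuclideanSpace ℝ m := toLp 2 (A *ᵥ ofLp y')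
      obtain ⟨z, hz, hzw⟩ := exists_dotProduct_mulVec_eq_norm A y'
      obtain ⟨z', hz', hzn, hzz⟩ := hT z hz
      have h1 := hmax (z', y') ⟨⟨hz', hzn⟩, hy', hyn⟩
      have h2 : ofLp (z - z') ⬝ᵥ A *ᵥ ofLp y' ≤ 1 / 2 * ‖w‖ := by
        have h2 := EuclideanSpace.inner_eq_star_dotProduct (𝕜 := ℝ) w (z - z')
        rw [star_trivial] at h2
        change ofLp (z - z') ⬝ᵥ ofLp w ≤ _
        rw [← h2]
        refine (real_inner_le_norm _ _).trans ?_
        rw [mul_comm]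
        gcongr
      rw [ofLp_sub, sub_dotProduct, hzw] at h2
      linarith
    have h3 : ofLp x ⬝ᵥ A *ᵥ ofLp y' ≤ 2 * c := by
      have h2 := EuclideanSpace.inner_eq_star_dotProduct (𝕜 := ℝ) (toLp 2 (A *ᵥ ofLp y')) x
      rw [star_trivial] at h2
      rw [← h2]
      refine (real_inner_le_norm _ _).trans ((mul_le_of_le_one_right (norm_nonneg _) hx).trans hw)
    have h4 : ofLp x ⬝ᵥ A *ᵥ ofLp (y - y') ≤ opNorm A / 2 := by
      refine (dotProduct_mulVec_le_opNorm A x (y - y')).trans ?_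
      have := opNorm_nonneg A
      calc opNorm A * ‖x‖ * ‖y - y'‖ ≤ opNorm A * 1 * (1 / 2) := by gcongr
        _ = _ := by ring
    rw [ofLp_sub, mulVec_sub, dotProduct_sub] at h4
    linarith
  linarith

end

/-! ### Blocks and banding. -/

section
open WithLp Matrix

/-- Extension by zero from a block of indices. -/
def extendBlock {p K k : ℕ} (u : EuclideanSpace ℝ (BlockIndex p K k)) :
    EuclideanSpace ℝ (Fin p) :=
  toLp 2 fun i => if h : k * K ≤ (i : ℕ) ∧ (i : ℕ) < (k + 1) * K then u ⟨i, h⟩ else 0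

/-- Used with g the identity for bilinear forms and g the square for norms; g 0 = 0 kills the
indices outside the block. -/
lemma sum_blockIndex_eq {p K k : ℕ} (f : Fin p → ℝ) (g : ℝ → ℝ) (hg : g 0 = 0)
    (u : EuclideanSpace ℝ (BlockIndex p K k)) :
    ∑ i : BlockIndex p K k, g (u i) * f i.1 = ∑ i, g (extendBlock u i) * f i := by
  rw [← Finset.sum_filter_of_ne (p := fun i : Fin p => k * K ≤ (i : ℕ) ∧ (i : ℕ) < (k + 1) * K)]
  · rw [Finset.sum_subtype (p := fun i : Fin p => k * K ≤ (i : ℕ) ∧ (i : ℕ) < (k + 1) * K) _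
      (by simp)]
    refine Finset.sum_congr rfl fun i _ => ?_
    simp only [extendBlock]
    rw [dif_pos i.2]
  · intro i _ hi
    by_contra h
    simp [extendBlock, h, hg] at hi

lemma norm_extendBlock {p K k : ℕ} (u : EuclideanSpace ℝ (BlockIndex p K k)) :
    ‖extendBlock u‖ = ‖u‖ := by
  have h := sum_blockIndex_eq (fun _ => 1) (fun x => x ^ 2) (by norm_num) u
  simp only [mul_one] at h
  simp only [EuclideanSpace.norm_eq, Real.norm_eq_abs, sq_abs, h]

/-- The matrix of the linear functional `A ↦ ⟨u, A(k, l) v⟩` applied to banded matrices. -/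
def bandedRankOne {p K k l : ℕ} (u : EuclideanSpace ℝ (BlockIndex p K k))
    (v : EuclideanSpace ℝ (BlockIndex p K l)) : Matrix (Fin p) (Fin p) ℝ :=
  fun i j => extendBlock u i * extendBlock v j *
    if |((i : ℕ) : ℤ) - ((j : ℕ) : ℤ)| ≤ (K : ℤ) - 1 then 1 else 0

lemma abs_bandedRankOne_le {p K k l : ℕ} (u : EuclideanSpace ℝ (BlockIndex p K k))
    (v : EuclideanSpace ℝ (BlockIndex p K l)) (i j : Fin p) :
    |bandedRankOne u v i j| ≤ |extendBlock u i| * |extendBlock v j| := by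
  rw [bandedRankOne, abs_mul, abs_mul]
  refine mul_le_of_le_one_right (by positivity) ?_
  split_ifs <;> simp

/-- Moves the banding from the random matrix to the test matrix, leaving a linear functional of the
unbanded error. -/
lemma dotProduct_block_band_mulVec {p K k l : ℕ} (A S : Matrix (Fin p) (Fin p) ℝ)
    (u : EuclideanSpace ℝ (BlockIndex p K k)) (v : EuclideanSpace ℝ (BlockIndex p K l)) :
    ofLp u ⬝ᵥ (block K (band K A) k l - block K (band K S) k l) *ᵥ ofLp v =
      ∑ i, ∑ j, bandedRankOne u v i j * (A i j - S i j) := by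
  have h1 : ∀ i : BlockIndex p K k,
      ((block K (band K A) k l - block K (band K S) k l) *ᵥ ofLp v) i =
        ∑ j, extendBlock v j * (band K A i.1 j - band K S i.1 j) := by
    intro i
    refine Eq.trans ?_ (sum_blockIndex_eq (fun j => band K A i.1 j - band K S i.1 j) id rfl v)
    simp only [Matrix.mulVec, dotProduct, id]
    exact Finset.sum_congr rfl fun j _ => mul_comm (band K A i.1 j.1 - band K S i.1 j.1) (v j)
  simp only [dotProduct, h1]
  refine (sum_blockIndex_eq (fun i => ∑ j, extendBlock v j * (band K A i j - band K S i j))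
    id rfl u).trans ?_
  simp only [id, Finset.mul_sum]
  refine Finset.sum_congr rfl fun i _ => Finset.sum_congr rfl fun j _ => ?_
  simp only [band, bandedRankOne]
  split_ifs <;> ring

lemma card_blockIndex_le (p K k : ℕ) : Fintype.card (BlockIndex p K k) ≤ K := by
  have h : Function.Injective (fun i : BlockIndex p K k =>
      (⟨(i.1 : ℕ) - k * K, by
        have h1 := i.2
        have h2 : (k + 1) * K = k * K + K := by ring
        omega⟩ : Fin K)) := by
    intro i j hij
    have h1 := i.2.1
    have h2 := j.2.1
    simp only [Fin.mk.injEq] at hij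
    exact Subtype.ext (Fin.ext (by omega))
  simpa using Fintype.card_le_of_injective _ h

lemma numBlocks_le {p K : ℕ} (hp : 1 ≤ p) (hK : 1 ≤ K) : numBlocks p K ≤ p := by
  refine Nat.div_le_of_le_mul ?_
  obtain ⟨a, rfl⟩ := Nat.exists_eq_add_of_le hp
  obtain ⟨b, rfl⟩ := Nat.exists_eq_add_of_le hK
  have : (1 + b) * (1 + a) = 1 + a + b + a * b := by ring
  rw [this]
  omega

lemma numBlocks_pos {p K : ℕ} (hp : 1 ≤ p) (hK : 1 ≤ K) : 0 < numBlocks p K :=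
  Nat.div_pos (by omega) hK

/-- The pairs of indices of blocks on or next to the diagonal. -/
abbrev NearPair (p K : ℕ) : Type :=
  {q : Fin (numBlocks p K) × Fin (numBlocks p K) // |((q.1 : ℕ) : ℤ) - ((q.2 : ℕ) : ℤ)| ≤ 1}

lemma card_nearPair_le {p K : ℕ} (hp : 1 ≤ p) (hK : 1 ≤ K) :
    Fintype.card (NearPair p K) ≤ p ^ 2 := by
  refine (Fintype.card_subtype_le _).trans ?_
  rw [Fintype.card_prod, Fintype.card_fin, sq]
  exact Nat.mul_le_mul (numBlocks_le hp hK) (numBlocks_le hp hK)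

lemma nonempty_nearPair {p K : ℕ} (hp : 1 ≤ p) (hK : 1 ≤ K) : Nonempty (NearPair p K) :=
  ⟨⟨(⟨0, numBlocks_pos hp hK⟩, ⟨0, numBlocks_pos hp hK⟩), by simp⟩⟩

lemma continuous_opNorm {X m n : Type*} [TopologicalSpace X] [Fintype m] [Fintype n]
    [DecidableEq n] {f : X → Matrix m n ℝ} (hf : Continuous f) :
    Continuous fun x => opNorm (f x) := by
  have h : Continuous fun A : Matrix m n ℝ =>
      LinearMap.toContinuousLinearMap (Matrix.toEuclideanLin A) :=
    ((LinearMap.toContinuousLinearMap (𝕜 := ℝ) (E := EuclideanSpace ℝ n)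
      (F' := EuclideanSpace ℝ m)).toLinearMap ∘ₗ
      (Matrix.toEuclideanLin (𝕜 := ℝ) (m := m) (n := n)).toLinearMap).continuous_of_finiteDimensional
  exact (h.comp hf).norm

lemma measurable_maxBlockDist_sampleCov {n p : ℕ} (K : ℕ) (S : Matrix (Fin p) (Fin p) ℝ) :
    Measurable fun x : Fin n → EuclideanSpace ℝ (Fin p) =>
      maxBlockDist K (band K (sampleCov x)) (band K S) := by
  unfold maxBlockDist
  refine Measurable.iSup fun q => (continuous_opNorm ?_).measurable
  refine continuous_matrix fun i j => ?_
  simp only [block, band, sampleCov, sampleMean, Matrix.sub_apply, Matrix.submatrix_apply]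
  split_ifs <;> fun_prop

end

/-! ### Exponential moment of the maximal block error. -/

section
variable {Ω : Type*} [MeasurableSpace Ω] {P : Measure Ω} [IsProbabilityMeasure P]

open Matrix WithLp

/-- Exponential moments of the maximal error of the blocks of the banded sample covariance
matrix. -/
lemma exp_maxBlockDist {n p K : ℕ} (hn : 2 ≤ n) (hp : 1 ≤ p) (hK : 1 ≤ K)
    {m : EuclideanSpace ℝ (Fin p)} {S : Matrix (Fin p) (Fin p) ℝ} (hS : S.PosSemidef)
    {X : Fin n → Ω → EuclideanSpace ℝ (Fin p)} (hX : iIndepFun X P)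
    (hlaw : ∀ a, HasLaw (X a) (multivariateGaussian m S) P) {s : ℝ} (hs0 : 0 ≤ s)
    (hs : 64 * (s * opNorm (absMatrix S)) ≤ n) :
    Integrable (fun ω => Real.exp
        (s * maxBlockDist K (band K (sampleCov fun a => X a ω)) (band K S))) P ∧
      ∫ ω, Real.exp (s * maxBlockDist K (band K (sampleCov fun a => X a ω)) (band K S)) ∂P ≤
        p ^ 2 * 25 ^ K * Real.exp (512 * ((s * opNorm (absMatrix S)) ^ 2 / n)) := by
  classical
  set L := opNorm (absMatrix S) with hL
  have hL0 : 0 ≤ L := opNorm_nonneg _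
  choose T hTcard hT using fun k : ℕ => exists_half_net (EuclideanSpace ℝ (BlockIndex p K k))
  set U : ∀ k : ℕ, Finset (EuclideanSpace ℝ (BlockIndex p K k)) := fun k => (T k).filter (‖·‖ ≤ 1)
  have hUcard : ∀ k, ((U k).card : ℝ) ≤ 5 ^ K := by
    intro k
    have h1 : (U k).card ≤ 5 ^ K := by
      refine (Finset.card_filter_le _ _).trans ((hTcard k).trans ?_)
      rw [finrank_euclideanSpace]
      exact Nat.pow_le_pow_right (by norm_num) (card_blockIndex_le p K k)
    exact_mod_cast h1
  set Q : ∀ k l : ℕ, EuclideanSpace ℝ (BlockIndex p K k) →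
      EuclideanSpace ℝ (BlockIndex p K l) → Ω → ℝ := fun _ _ u v ω =>
    ∑ i, ∑ j, bandedRankOne u v i j * (sampleCov (fun a => X a ω) i j - S i j) with hQ
  have hterm : ∀ (k l : ℕ) (u : EuclideanSpace ℝ (BlockIndex p K k))
      (v : EuclideanSpace ℝ (BlockIndex p K l)), u ∈ U k → v ∈ U l →
      Integrable (fun ω => Real.exp (4 * s * Q _ _ u v ω)) P ∧
        ∫ ω, Real.exp (4 * s * Q _ _ u v ω) ∂P ≤ Real.exp (512 * ((s * L) ^ 2 / n)) := by
    intro k l u v hu hv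
    have hu1 : ‖extendBlock u‖ ≤ 1 := by
      rw [norm_extendBlock]; exact (Finset.mem_filter.1 hu).2
    have hv1 : ‖extendBlock v‖ ≤ 1 := by
      rw [norm_extendBlock]; exact (Finset.mem_filter.1 hv).2
    -- The 4 is the net constant: 256 · 4² = 64² gives the condition on s, and 32 · 4² = 512 the
    -- exponent.
    have h := exp_sampleCov (s := 4 * s) hn hS hX hlaw (bandedRankOne u v)
      (trace_mul_mul_mul_transpose_le hu1 hv1 (abs_bandedRankOne_le u v)) (sq_nonneg _) (by
        have h1 : (64 * (s * L)) ^ 2 ≤ (n : ℝ) ^ 2 :=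
          pow_le_pow_left₀ (by positivity) hs 2
        rw [← hL]
        linarith)
    refine ⟨h.1, h.2.trans_eq ?_⟩
    rw [← hL]
    congr 1
    ring
  set G : Ω → ℝ := fun ω => ∑ q : NearPair p K, ∑ u ∈ U q.1.1, ∑ v ∈ U q.1.2,
    Real.exp (4 * s * Q _ _ u v ω) with hG
  have hdom : ∀ ω, Real.exp (s * maxBlockDist K (band K (sampleCov fun a => X a ω)) (band K S)) ≤
      G ω := by
    intro ω
    have := nonempty_nearPair hp hK
    obtain ⟨q, hq⟩ := exists_eq_ciSup_of_finite (f := fun q : NearPair p K =>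
      opNorm (block K (band K (sampleCov fun a => X a ω)) q.1.1 q.1.2 -
        block K (band K S) q.1.1 q.1.2))
    obtain ⟨u, hu, v, hv, hu1, hv1, huv⟩ := exists_opNorm_le_four_mul
      (block K (band K (sampleCov fun a => X a ω)) q.1.1 q.1.2 - block K (band K S) q.1.1 q.1.2)
      (hT q.1.1) (hT q.1.2)
    rw [dotProduct_block_band_mulVec] at huv
    have h1 : Real.exp (s * maxBlockDist K (band K (sampleCov fun a => X a ω)) (band K S)) ≤
        Real.exp (4 * s * Q _ _ u v ω) := by
      refine Real.exp_le_exp.2 ?_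
      rw [maxBlockDist, ← hq, mul_comm 4 s, mul_assoc]
      exact mul_le_mul_of_nonneg_left huv hs0
    refine h1.trans ?_
    have h2 := Finset.single_le_sum (f := fun v => Real.exp (4 * s * Q _ _ u v ω)) (s := U q.1.2)
      (fun _ _ => (Real.exp_pos _).le) (Finset.mem_filter.2 ⟨hv, hv1⟩)
    have h3 := Finset.single_le_sum (s := U q.1.1)
      (f := fun u => ∑ v ∈ U q.1.2, Real.exp (4 * s * Q _ _ u v ω))
      (fun _ _ => Finset.sum_nonneg fun _ _ => (Real.exp_pos _).le)
      (Finset.mem_filter.2 ⟨hu, hu1⟩)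
    have h4 := Finset.single_le_sum (s := Finset.univ)
      (f := fun q : NearPair p K => ∑ u ∈ U q.1.1, ∑ v ∈ U q.1.2, Real.exp (4 * s * Q _ _ u v ω))
      (fun _ _ => Finset.sum_nonneg fun _ _ => Finset.sum_nonneg fun _ _ => (Real.exp_pos _).le)
      (Finset.mem_univ q)
    exact h2.trans (h3.trans h4)
  have hGI : Integrable G P :=
    integrable_finsetSum _ fun q _ => integrable_finsetSum _ fun u hu =>
      integrable_finsetSum _ fun v hv => (hterm _ _ u v hu hv).1
  have hXm : AEMeasurable (fun ω a => X a ω) P :=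
    aemeasurable_pi_lambda _ fun a => (hlaw a).aemeasurable
  have hI : Integrable (fun ω => Real.exp
      (s * maxBlockDist K (band K (sampleCov fun a => X a ω)) (band K S))) P := by
    refine hGI.mono' ?_ (ae_of_all _ fun ω => ?_)
    · exact (Real.measurable_exp.comp ((measurable_maxBlockDist_sampleCov K S).const_mul s)
        |>.comp_aemeasurable hXm).aestronglyMeasurable
    · rw [Real.norm_of_nonneg (Real.exp_pos _).le]
      exact hdom ω
  refine ⟨hI, (integral_mono hI hGI hdom).trans ?_⟩
  rw [hG, integral_finsetSum _ fun q _ => integrable_finsetSum _ fun u hu =>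
      integrable_finsetSum _ fun v hv => (hterm _ _ u v hu hv).1]
  set E := Real.exp (512 * ((s * L) ^ 2 / n)) with hE
  have hE0 : 0 < E := Real.exp_pos _
  have hq : ∀ q : NearPair p K, ∫ ω, ∑ u ∈ U q.1.1, ∑ v ∈ U q.1.2, Real.exp (4 * s * Q _ _ u v ω) ∂P
      ≤ 25 ^ K * E := by
    intro q
    rw [integral_finsetSum _ fun u hu =>
      integrable_finsetSum _ fun v hv => (hterm _ _ u v hu hv).1]
    have h1 : ∀ u ∈ U q.1.1, ∫ ω, ∑ v ∈ U q.1.2, Real.exp (4 * s * Q _ _ u v ω) ∂P ≤ 5 ^ K * E := by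
      intro u hu
      rw [integral_finsetSum _ fun v hv => (hterm _ _ u v hu hv).1]
      refine (Finset.sum_le_card_nsmul _ _ _ fun v hv => (hterm _ _ u v hu hv).2).trans ?_
      rw [nsmul_eq_mul]
      exact mul_le_mul_of_nonneg_right (hUcard _) hE0.le
    refine (Finset.sum_le_card_nsmul _ _ _ h1).trans ?_
    rw [nsmul_eq_mul]
    calc _ ≤ (5 : ℝ) ^ K * (5 ^ K * E) := mul_le_mul_of_nonneg_right (hUcard _) (by positivity)
      _ = 25 ^ K * E := by rw [← mul_assoc, ← mul_pow]; norm_num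
  refine (Finset.sum_le_card_nsmul _ _ _ fun q _ => hq q).trans ?_
  rw [nsmul_eq_mul, Finset.card_univ, mul_assoc]
  refine mul_le_mul_of_nonneg_right ?_ (by positivity)
  exact_mod_cast card_nearPair_le hp hK

end

/-! ### Consequences of membership in the class. -/

section
open Matrix WithLp

variable {p : ℕ} {α M₀ M₁ : ℝ} {S : Matrix (Fin p) (Fin p) ℝ}

lemma ApproxBanded.posSemidef (h : ApproxBanded α M₀ M₁ S) : S.PosSemidef := by
  obtain ⟨h0, hS, hev⟩ := h.spectrum
  exact hS.posSemidef_iff_eigenvalues_nonneg.2 fun i => h0.le.trans (hev i).1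

/-- A diagonal entry is an average of the eigenvalues, weighted by the squared coordinates of a
basis vector in the eigenbasis. -/
lemma ApproxBanded.diag_mem_Icc (h : ApproxBanded α M₀ M₁ S) (j : Fin p) :
    S j j ∈ Set.Icc M₀⁻¹ M₀ := by
  obtain ⟨h0, hS, hev⟩ := h.spectrum
  set b := hS.eigenvectorBasis
  set e : EuclideanSpace ℝ (Fin p) := EuclideanSpace.single j 1 with he
  have h1 := hS.dotProduct_mulVec_sum_eigenvectorBasis (fun i => inner ℝ (b i) e)
  rw [b.sum_repr'] at h1
  have h2 : ofLp e ⬝ᵥ S *ᵥ ofLp e = S j j := by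
    simp [he]
  have h3 : ∑ i, inner ℝ (b i) e ^ 2 = 1 := by
    have := b.sum_sq_norm_inner_right e
    simpa [he] using this
  rw [h2] at h1
  rw [h1]
  constructor
  · calc M₀⁻¹ = ∑ i, M₀⁻¹ * inner ℝ (b i) e ^ 2 := by rw [← Finset.mul_sum, h3, mul_one]
      _ ≤ _ := Finset.sum_le_sum fun i _ => mul_le_mul_of_nonneg_right (hev i).1 (sq_nonneg _)
  · calc _ ≤ ∑ i, M₀ * inner ℝ (b i) e ^ 2 :=
          Finset.sum_le_sum fun i _ => mul_le_mul_of_nonneg_right (hev i).2 (sq_nonneg _)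
      _ = M₀ := by rw [← Finset.mul_sum, h3, mul_one]

lemma ApproxBanded.opNorm_absMatrix_pos (h : ApproxBanded α M₀ M₁ S) (hp : 1 ≤ p) :
    0 < opNorm (absMatrix S) := by
  obtain ⟨h0, -⟩ := h.spectrum
  have h1 := (h.diag_mem_Icc ⟨0, hp⟩).1
  set e : EuclideanSpace ℝ (Fin p) := EuclideanSpace.single ⟨0, hp⟩ 1 with he
  have h2 := dotProduct_mulVec_le_opNorm (absMatrix S) e e
  have h3 : ofLp e ⬝ᵥ absMatrix S *ᵥ ofLp e = |S ⟨0, hp⟩ ⟨0, hp⟩| := by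
    simp [he, absMatrix]
  have h4 : ‖e‖ = 1 := by simp [he]
  rw [h3, h4, mul_one, mul_one] at h2
  linarith [le_abs_self (S ⟨0, hp⟩ ⟨0, hp⟩)]

/-- Only the decay at k = 1 is needed, where k^(-α) = 1; hence no constant depends on α. The
diagonal entry adds at most M₀. -/
lemma ApproxBanded.sum_abs_le (h : ApproxBanded α M₀ M₁ S) (j : Fin p) :
    ∑ i, |S i j| ≤ M₀ + M₁ := by
  have h1 := h.decay 1 one_pos j
  simp only [Nat.cast_one, Real.one_rpow, mul_one] at h1
  have h2 := h.diag_mem_Icc j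
  have h3 : |S j j| ≤ M₀ := by
    rw [abs_of_nonneg (h.spectrum.1.le.trans h2.1)]; exact h2.2
  have h4 : ∑ i ∈ Finset.univ.filter
      (fun i : Fin p => ¬ (1 : ℤ) ≤ |((i : ℕ) : ℤ) - ((j : ℕ) : ℤ)|), |S i j| = |S j j| := by
    have : Finset.univ.filter
        (fun i : Fin p => ¬ (1 : ℤ) ≤ |((i : ℕ) : ℤ) - ((j : ℕ) : ℤ)|) = {j} := by
      ext i
      simp only [Finset.mem_filter, Finset.mem_univ, true_and, Finset.mem_singleton, not_le,
        Int.abs_lt_one_iff, sub_eq_zero, Nat.cast_inj, Fin.ext_iff]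
    rw [this, Finset.sum_singleton]
  rw [← Finset.sum_filter_add_sum_filter_not Finset.univ
    (fun i : Fin p => (1 : ℤ) ≤ |((i : ℕ) : ℤ) - ((j : ℕ) : ℤ)|), h4]
  linarith

/-- Schur's test for the matrix of absolute values. -/
lemma ApproxBanded.opNorm_absMatrix_le (h : ApproxBanded α M₀ M₁ S) (hp : 1 ≤ p) :
    opNorm (absMatrix S) ≤ M₀ + M₁ := by
  have hR : 0 ≤ M₀ + M₁ :=
    (Finset.sum_nonneg fun i _ => abs_nonneg (S i ⟨0, hp⟩)).trans (h.sum_abs_le ⟨0, hp⟩)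
  have hsym : ∀ i j, S i j = S j i := by
    intro i j
    simpa using (h.posSemidef.isHermitian.apply i j).symm
  refine opNorm_le_of_forall_dotProduct_le fun u v hu hv => ?_
  have hsq : ∀ w : EuclideanSpace ℝ (Fin p), ‖w‖ ≤ 1 → ∑ i, w i ^ 2 ≤ 1 := by
    intro w hw
    rw [← EuclideanSpace.real_norm_sq_eq]
    exact pow_le_one₀ (norm_nonneg _) hw
  have h1 : ofLp u ⬝ᵥ absMatrix S *ᵥ ofLp v ≤
      ∑ i, ∑ j, (2⁻¹ * (|S i j| * u i ^ 2) + 2⁻¹ * (|S i j| * v j ^ 2)) := by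
    simp only [dotProduct, Matrix.mulVec, absMatrix, Finset.mul_sum]
    refine Finset.sum_le_sum fun i _ => Finset.sum_le_sum fun j _ => ?_
    nlinarith [mul_nonneg (abs_nonneg (S i j)) (sq_nonneg (u i - v j))]
  have h2 : ∑ i, ∑ j, |S i j| * u i ^ 2 ≤ M₀ + M₁ := by
    calc ∑ i, ∑ j, |S i j| * u i ^ 2 ≤ ∑ i, (M₀ + M₁) * u i ^ 2 := by
          refine Finset.sum_le_sum fun i _ => ?_
          rw [← Finset.sum_mul]
          refine mul_le_mul_of_nonneg_right ?_ (sq_nonneg _)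
          simp only [hsym i]
          exact h.sum_abs_le i
      _ ≤ M₀ + M₁ := by
          rw [← Finset.mul_sum]; exact mul_le_of_le_one_right hR (hsq u hu)
  have h3 : ∑ i, ∑ j, |S i j| * v j ^ 2 ≤ M₀ + M₁ := by
    rw [Finset.sum_comm]
    calc ∑ j, ∑ i, |S i j| * v j ^ 2 ≤ ∑ j, (M₀ + M₁) * v j ^ 2 := by
          refine Finset.sum_le_sum fun j _ => ?_
          rw [← Finset.sum_mul]
          exact mul_le_mul_of_nonneg_right (h.sum_abs_le j) (sq_nonneg _)
      _ ≤ M₀ + M₁ := by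
          rw [← Finset.mul_sum]; exact mul_le_of_le_one_right hR (hsq v hv)
  simp only [Finset.sum_add_distrib, ← Finset.mul_sum] at h1
  linarith

end

/-! ### Tail and second moment. -/

lemma maxBlockDist_nonneg {p : ℕ} (K : ℕ) (A B : Matrix (Fin p) (Fin p) ℝ) :
    0 ≤ maxBlockDist K A B :=
  Real.iSup_nonneg fun _ => opNorm_nonneg _

/-- For x ≥ a, x² ≤ 2a² + 2(x - a)², and y²/2 ≤ exp y at y = s(x - a) bounds the last term. -/
lemma sq_le_add_exp {s a x : ℝ} (hs : 0 < s) (hx : 0 ≤ x) :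
    x ^ 2 ≤ 2 * a ^ 2 + 4 / s ^ 2 * Real.exp (-(s * a)) * Real.exp (s * x) := by
  have he : Real.exp (-(s * a)) * Real.exp (s * x) = Real.exp (s * (x - a)) := by
    rw [← Real.exp_add]; congr 1; ring
  rw [mul_assoc, he]
  rcases le_total x a with h | h
  · have : 0 ≤ 4 / s ^ 2 * Real.exp (s * (x - a)) := by positivity
    nlinarith
  · have h1 := Real.quadratic_le_exp_of_nonneg (mul_nonneg hs.le (sub_nonneg.2 h))
    have h2 : 2 * (x - a) ^ 2 ≤ 4 / s ^ 2 * Real.exp (s * (x - a)) := by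
      rw [div_mul_eq_mul_div, le_div_iff₀ (by positivity)]
      have := mul_nonneg hs.le (sub_nonneg.2 h)
      nlinarith
    nlinarith [sq_nonneg (x - 2 * a)]

theorem proposition2 (γ : ℝ) :
    ∃ c C : ℝ, 0 < c ∧ 0 < C ∧ ∀ M₀ M₁ : ℝ, ∃ D : ℝ, 0 < D ∧
      ∀ (α : ℝ) (n p K : ℕ), 2 ≤ n → 1 ≤ p → 1 ≤ K → (K : ℝ) + Real.log p ≤ γ * n →
      ∀ (S : Matrix (Fin p) (Fin p) ℝ), ApproxBanded α M₀ M₁ S →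
      ∀ (m : EuclideanSpace ℝ (Fin p))
        {Ω : Type*} [MeasurableSpace Ω] (P : Measure Ω) [IsProbabilityMeasure P]
        (X : Fin n → Ω → EuclideanSpace ℝ (Fin p)),
        iIndepFun X P → (∀ a, HasLaw (X a) (multivariateGaussian m S) P) →
        P.real {ω | c * opNorm (absMatrix S) * √(((K : ℝ) + Real.log p) / n) ≤
            maxBlockDist K (band K (sampleCov fun a => X a ω)) (band K S)} ≤ C / p ∧
        Integrable
          (fun ω => maxBlockDist K (band K (sampleCov fun a => X a ω)) (band K S) ^ 2) P ∧
        ∫ ω, maxBlockDist K (band K (sampleCov fun a => X a ω)) (band K S) ^ 2 ∂P ≤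
          D * (((K : ℝ) + Real.log p) / n) := by
  set G : ℝ := max γ 1 with hG
  have hG1 : 1 ≤ G := le_max_right _ _
  have hGγ : γ ≤ G := le_max_left _ _
  -- 384 = 6 · 64 makes s a = 6h below; against the moment bound exp(5h) this leaves exp(-h) ≤ 1/p.
  refine ⟨384 * G, 1, by positivity, one_pos, fun M₀ M₁ => ?_⟩
  -- The two terms come from 2a² and 4/s², with 16384 = 4 · 64²; the `+ 1` keeps D positive even if
  -- M₀ + M₁ = 0.
  refine ⟨(2 * (384 * G) ^ 2 + 16384 * G ^ 2) * (M₀ + M₁) ^ 2 + 1, by positivity, ?_⟩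
  intro α n p K hn hp hK hγ S hS m Ω _ P _ X hX hlaw
  set W : Ω → ℝ := fun ω => maxBlockDist K (band K (sampleCov fun a => X a ω)) (band K S)
  set L := opNorm (absMatrix S)
  have hL0 : 0 < L := hS.opNorm_absMatrix_pos hp
  have hLM : L ≤ M₀ + M₁ := hS.opNorm_absMatrix_le hp
  have hn0 : (0 : ℝ) < n := by positivity
  have hp0 : (0 : ℝ) < p := by positivity
  have hlog : 0 ≤ Real.log p := Real.log_natCast_nonneg p
  have hK1 : (1 : ℝ) ≤ K := by exact_mod_cast hK
  set h : ℝ := K + Real.log p with hh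
  have hh1 : 1 ≤ h := by linarith
  set r : ℝ := √(h / n) with hr
  have hr0 : 0 < r := Real.sqrt_pos.2 (by positivity)
  have hr2 : r ^ 2 = h / n := Real.sq_sqrt (by positivity)
  have hnr : n * r ^ 2 = h := by rw [hr2]; field_simp
  have hrG : r ≤ G := by
    rw [hr, Real.sqrt_le_iff]
    refine ⟨by linarith, ?_⟩
    rw [div_le_iff₀ hn0]
    have h1 : γ * n ≤ G ^ 2 * n := by
      gcongr
      nlinarith
    linarith
  -- Since r ≤ G, this satisfies 64 s L ≤ n; here the hypothesis K + log p ≤ γ n enters.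
  set s : ℝ := n * r / (64 * L * G) with hs
  have hs0 : 0 < s := by positivity
  have hsL : s * L = n * r / (64 * G) := by rw [hs]; field_simp
  obtain ⟨hI, hB⟩ := exp_maxBlockDist hn hp hK hS.posSemidef hX hlaw hs0.le (by
    rw [hsL, mul_div_assoc', div_le_iff₀ (by positivity)]
    nlinarith [mul_le_mul_of_nonneg_left hrG hn0.le])
  have hB' : ∫ ω, Real.exp (s * W ω) ∂P ≤ Real.exp (5 * h) := by
    refine hB.trans ?_
    have h1 : (p : ℝ) ^ 2 = Real.exp (2 * Real.log p) := by
      rw [two_mul, Real.exp_add, Real.exp_log hp0, sq]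
    have h2 : (25 : ℝ) ^ K ≤ Real.exp (4 * K) := by
      rw [mul_comm, Real.exp_nat_mul]
      refine pow_le_pow_left₀ (by norm_num) ?_ K
      have h3 : Real.exp 4 = Real.exp 1 ^ 4 := by rw [← Real.exp_nat_mul]; norm_num
      have h4 := Real.exp_one_gt_d9
      rw [h3]
      calc (25 : ℝ) ≤ 2.5 ^ 4 := by norm_num
        _ ≤ Real.exp 1 ^ 4 := pow_le_pow_left₀ (by norm_num) (by linarith) 4
    have h3 : 512 * ((s * L) ^ 2 / n) ≤ h := by
      rw [hsL, div_pow, mul_pow, mul_pow]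
      have h4 : 512 * ((n : ℝ) ^ 2 * r ^ 2 / (64 ^ 2 * G ^ 2) / n) = h / (8 * G ^ 2) := by
        rw [← hnr]; field_simp; norm_num
      rw [h4]
      exact div_le_self (by linarith) (by nlinarith)
    calc (p : ℝ) ^ 2 * 25 ^ K * Real.exp (512 * ((s * L) ^ 2 / n))
        ≤ Real.exp (2 * Real.log p) * Real.exp (4 * K) * Real.exp h := by
          rw [h1]; gcongr
      _ = Real.exp (2 * Real.log p + 4 * K + h) := by rw [← Real.exp_add, ← Real.exp_add]
      _ ≤ Real.exp (5 * h) := Real.exp_le_exp.2 (by linarith)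
  set a : ℝ := 384 * G * L * r with ha
  have hsa : s * a = 6 * h := by rw [← hnr, hs, ha]; field_simp; norm_num
  have htail : Real.exp (-(s * a)) * Real.exp (5 * h) = Real.exp (-h) := by
    rw [hsa, ← Real.exp_add]; congr 1; ring
  have hWm : AEStronglyMeasurable W P :=
    ((measurable_maxBlockDist_sampleCov K S).comp_aemeasurable
      (aemeasurable_pi_lambda _ fun a => (hlaw a).aemeasurable)).aestronglyMeasurable
  have hW0 : ∀ ω, 0 ≤ W ω := fun ω => maxBlockDist_nonneg _ _ _
  have hdom : ∀ ω, W ω ^ 2 ≤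
      2 * a ^ 2 + 4 / s ^ 2 * Real.exp (-(s * a)) * Real.exp (s * W ω) :=
    fun ω => sq_le_add_exp hs0 (hW0 ω)
  have hdomI : Integrable (fun ω => 2 * a ^ 2 +
      4 / s ^ 2 * Real.exp (-(s * a)) * Real.exp (s * W ω)) P :=
    (integrable_const _).add (hI.const_mul _)
  have hW2 : Integrable (fun ω => W ω ^ 2) P := by
    refine hdomI.mono' (hWm.pow 2) (ae_of_all _ fun ω => ?_)
    rw [Real.norm_of_nonneg (sq_nonneg _)]
    exact hdom ω
  refine ⟨?_, hW2, ?_⟩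
  · refine (measure_ge_le_exp_mul_mgf a hs0.le hI).trans ?_
    calc Real.exp (-s * a) * mgf W P s ≤ Real.exp (-(s * a)) * Real.exp (5 * h) := by
          rw [neg_mul]
          exact mul_le_mul_of_nonneg_left hB' (Real.exp_pos _).le
      _ = Real.exp (-h) := htail
      _ ≤ Real.exp (-Real.log p) := Real.exp_le_exp.2 (by linarith)
      _ = 1 / p := by rw [Real.exp_neg, Real.exp_log hp0, one_div]
  · have h1 : ∫ ω, W ω ^ 2 ∂P ≤ 2 * a ^ 2 + 4 / s ^ 2 := by
      refine (integral_mono hW2 hdomI hdom).trans ?_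
      rw [integral_add (integrable_const _) (hI.const_mul _), integral_const, integral_const_mul,
        probReal_univ, one_smul]
      gcongr
      calc 4 / s ^ 2 * Real.exp (-(s * a)) * ∫ ω, Real.exp (s * W ω) ∂P
          ≤ 4 / s ^ 2 * Real.exp (-(s * a)) * Real.exp (5 * h) := by gcongr
        _ = 4 / s ^ 2 * Real.exp (-h) := by rw [mul_assoc, htail]
        _ ≤ 4 / s ^ 2 := by
            have he : Real.exp (-h) ≤ 1 := Real.exp_le_one_iff.2 (by linarith)
            exact mul_le_of_le_one_right (by positivity) he
    have h2 : 4 / s ^ 2 ≤ 16384 * G ^ 2 * L ^ 2 * r ^ 2 := by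
      have h3 : 4 / s ^ 2 = 16384 * G ^ 2 * L ^ 2 * r ^ 2 / h ^ 2 := by
        rw [← hnr, hs]; field_simp; norm_num
      rw [h3]
      exact div_le_self (by positivity) (one_le_pow₀ hh1)
    have h3 : L ^ 2 ≤ (M₀ + M₁) ^ 2 := pow_le_pow_left₀ hL0.le hLM 2
    rw [← hr2]
    calc ∫ ω, W ω ^ 2 ∂P ≤ 2 * a ^ 2 + 16384 * G ^ 2 * L ^ 2 * r ^ 2 := h1.trans (by gcongr)
      _ = (2 * (384 * G) ^ 2 + 16384 * G ^ 2) * L ^ 2 * r ^ 2 := by rw [ha]; ring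
      _ ≤ (2 * (384 * G) ^ 2 + 16384 * G ^ 2) * (M₀ + M₁) ^ 2 * r ^ 2 := by gcongr
      _ ≤ _ := by
        rw [add_mul _ (1 : ℝ), one_mul]
        exact le_add_of_nonneg_right (sq_nonneg r)
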